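/- For a matroid $M$ of rank $k$ on $[n]=\{1,\dots,n\}$ and $S\subseteq[n]$, put $c(S)=\#S-\operatorname{rk}S$ and define $a(S)$ recursively by $a(S)=c(S)-\sum_{T\subsetneq S}a(T)$ (so $a(\varnothing)=0$). The expected codimension of $M$ is $$\operatorname{ec}(M)=\sum_{S\subseteq[n]}(k-\operatorname{rk}S)\,a(S)\in\mathbb Z .$$ The matroid polytope $P(M)\subset\mathbb R^n$ is the convex hull of the $0/1$ indicator vectors of the bases of $M$. A matroidal subdivision $\mathcal D$ of $P(M)$ is a finite polytopal complex (closed under taking nonempty faces, any two cells meeting in a common, possibly empty, face of both) with union $P(M)$, all of whose nonempty cells are matroid polytopes of matroids on $[n]$. Write $\mathcal D_{in}$ for its internal faces, that is, the nonempty cells of $\mathcal D$ that are not contained in the relative boundary of $P(M)$. **Theorem.** Expected codimension is a valuative matroid invariant. That is, for every $n$: isomorphic matroids on $[n]$ have the same expected codimension, and for every matroid $M$ on $[n]$ and every matroidal subdivision $\mathcal D$ of $P(M)$, $$\operatorname{ec}(M)=\sum_{P(N)\in\mathcal D_{in}}(-1)^{\dim P(M)-\dim P(N)}\operatorname{ec}(N).$$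 -/

import Mathlib

namespace MatroidEC

/-- The set of all matroids on the ground set `[n]` (modelled by all of `Fin n`). -/
abbrev Mat (n : ℕ) : Type := {M : Matroid (Fin n) // M.E = Set.univ}

instance instFiniteMat (n : ℕ) : Finite (Mat n) := by
  refine Finite.of_injective (β := Set (Set (Fin n))) (fun M => {B | M.1.IsBase B}) ?_
  intro M N h
  refine Subtype.ext (Matroid.ext_isBase (M.2.trans N.2.symm) ?_)
  intro B _
  exact Set.ext_iff.1 h B

noncomputable instance instFintypeMat (n : ℕ) : Fintype (Mat n) := Fintype.ofFinite _

/-! ### Expected codimension -/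

/-- The rank `rk S` of a set of elements, as an integer (all ranks are finite here). -/
noncomputable def rk {n : ℕ} (M : Mat n) (S : Finset (Fin n)) : ℤ :=
  ((M.1.eRk (S : Set (Fin n))).toNat : ℤ)

/-- The rank `k` of the matroid. -/
noncomputable def rank {n : ℕ} (M : Mat n) : ℤ := (M.1.eRank.toNat : ℤ)

/-- `c(S) = #S - rk S`. -/
noncomputable def c {n : ℕ} (M : Mat n) (S : Finset (Fin n)) : ℤ := (S.card : ℤ) - rk M S

/-- `a_𝔖(S) = c(S) - ∑_{T ∈ 𝔖, T ⊊ S} a_𝔖(T)`, by recursion on `#S`. At `S = ∅` the sum is empty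
and `c(∅) = 0`, so `a_𝔖(∅) = 0`. -/
noncomputable def a {n : ℕ} (M : Mat n) (𝔖 : Finset (Finset (Fin n))) (S : Finset (Fin n)) : ℤ :=
  c M S - ∑ T ∈ (𝔖.filter (fun T => T ⊂ S)).attach, a M 𝔖 T.1
termination_by S.card
decreasing_by exact Finset.card_lt_card (Finset.mem_filter.1 T.2).2

/-- The expected codimension with respect to a collection `𝔖` of subsets. -/
noncomputable def ecWith {n : ℕ} (𝔖 : Finset (Finset (Fin n))) (M : Mat n) : ℤ :=
  ∑ S ∈ 𝔖, (rank M - rk M S) * a M 𝔖 S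

/-- The expected codimension: take `𝔖` to be the collection of all subsets of `[n]`. -/
noncomputable def ec {n : ℕ} (M : Mat n) : ℤ := ecWith Finset.univ M

/-! ### Matroid polytopes and their subdivisions -/

/-- The matroid polytope `P(M)` in `ℝⁿ`: the convex hull of the 0/1 indicator vectors of bases. -/
noncomputable def polytope {n : ℕ} (M : Mat n) : Set (Fin n → ℝ) :=
  convexHull ℝ {v | ∃ B : Set (Fin n), M.1.IsBase B ∧ v = B.indicator (fun _ => (1 : ℝ))}

/-- The dimension of a (nonempty) convex set: the dimension of its affine span. -/
noncomputable def dim {n : ℕ} (P : Set (Fin n → ℝ)) : ℕ := Module.finrank ℝ (vectorSpan ℝ P)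

/-- `D` is (the set of all nonempty cells of) a polyhedral subdivision of `P`: a finite polytopal
complex with union `P`. For a polytope `F`, `IsExposed ℝ F G` says that `G` is a face of `F`
(possibly empty or `F` itself). -/
structure IsSubdivision {n : ℕ} (P : Set (Fin n → ℝ)) (D : Set (Set (Fin n → ℝ))) : Prop where
  finite : D.Finite
  isPolytope : ∀ F ∈ D, ∃ V : Set (Fin n → ℝ), V.Finite ∧ V.Nonempty ∧ F = convexHull ℝ V
  face_mem : ∀ F ∈ D, ∀ G, G.Nonempty → IsExposed ℝ F G → G ∈ D
  inter_face : ∀ F ∈ D, ∀ G ∈ D, IsExposed ℝ F (F ∩ G) ∧ IsExposed ℝ G (F ∩ G)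
  sUnion_eq : ⋃₀ D = P

/-- A matroidal subdivision of `P(M)`: a subdivision all of whose cells are matroid polytopes. -/
structure IsMatroidalSubdivision {n : ℕ} (M : Mat n) (D : Set (Set (Fin n → ℝ))) : Prop
    extends IsSubdivision (polytope M) D where
  isMatroidPolytope : ∀ F ∈ D, ∃ N : Mat n, polytope N = F

/-- The internal faces of a subdivision `D` of `P`: those not contained in the (relative)
boundary of `P`. -/
def internalFaces {n : ℕ} (P : Set (Fin n → ℝ)) (D : Set (Set (Fin n → ℝ))) :
    Set (Set (Fin n → ℝ)) :=
  {F | F ∈ D ∧ ¬ F ⊆ intrinsicFrontier ℝ P}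

open Classical in
/-- `f` is valuative: `f(M) = ∑_{P(N) ∈ D_in} (-1)^{dim P(M) - dim P(N)} f(N)` for every matroidal
subdivision `D` of `P(M)`. Here `P(N) ⊆ P(M)`, so that the exponent is a true difference, and
a matroid is determined by its polytope, so that each internal face is counted once. -/
def IsValuative {n : ℕ} {A : Type*} [AddCommGroup A] (f : Mat n → A) : Prop :=
  ∀ (M : Mat n) (D : Set (Set (Fin n → ℝ))), IsMatroidalSubdivision M D →
    f M = ∑ N : Mat n with polytope N ∈ internalFaces (polytope M) D,
      (-1 : ℤ) ^ (dim (polytope M) - dim (polytope N)) • f N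

/-- `f` is a matroid invariant: it takes equal values on isomorphic matroids. -/
def IsInvariant {n : ℕ} {A : Type*} (f : Mat n → A) : Prop :=
  ∀ (M N : Mat n) (σ : Equiv.Perm (Fin n)),
    (∀ B : Set (Fin n), M.1.IsBase B ↔ N.1.IsBase (σ '' B)) → f M = f N

end MatroidEC

/-! Unfolding the recursion, `a(S)` is an integer combination of the numbers `c(T)`, `T ⊆ S`, with
coefficients independent of the matroid. Hence `ec` is a combination of ranks and of products `rk T
* rk R` with `T ⊆ R`, and valuativeness of these suffices (`isValuative_rk_mul_a`).

Such a product counts the pairs `i, j ≥ 1` with `i ≤ rk T` and `j ≤ rk R`. Since `T` and `R` are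
nested, one basis attains both ranks (`exists_isBase_rk_eq`), so the two inequalities hold exactly
when `P(M)` meets the open convex set `x(T) > i - 1/2`, `x(R) > j - 1/2` (`isValuative_le_rk`).

Meeting an open convex set `Q` is valuative (`isValuative_inter_nonempty`): the relative interior of
`P(M)` is the disjoint union of those of the internal cells, and this persists after intersection
with `Q`. The Euler characteristic with compact support is additive and equals `(-1) ^ dim` on a
nonempty bounded relatively open convex set. Additivity is proved by slicing along coordinates
(`sum_euler_eq_zero`).

Invariance holds because an isomorphism preserves ranks and permutes the subsets. -/

namespace MatroidEC

open Set Topology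

variable {n : ℕ}

/-! ### Relative interiors of convex sets -/

/-- A convex set is the trace on its affine span of a convex set `C` of full dimension, and its
relative interior is then the trace of the interior of `C`. -/
theorem exists_thickening {K : Set (Fin n → ℝ)} (hK : Convex ℝ K) (hne : K.Nonempty) :
    ∃ C : Set (Fin n → ℝ), Convex ℝ C ∧ (∀ x ∈ affineSpan ℝ K, x ∈ C ↔ x ∈ K) ∧
      intrinsicInterior ℝ K = K ∩ interior C := by
  obtain ⟨x₀, hx₀⟩ := hne
  obtain ⟨π, hπ⟩ := (vectorSpan ℝ K).subtype.exists_leftInverse_of_injective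
    (Submodule.ker_subtype _)
  have hπ' : ∀ w ∈ vectorSpan ℝ K, (π w : Fin n → ℝ) = w := fun w hw =>
    congrArg Subtype.val (LinearMap.congr_fun hπ ⟨w, hw⟩)
  have hx₀' : x₀ ∈ affineSpan ℝ K := subset_affineSpan ℝ K hx₀
  have hmem : ∀ x, (π (x - x₀) : Fin n → ℝ) + x₀ ∈ affineSpan ℝ K := fun x => by
    refine AffineSubspace.vadd_mem_of_mem_direction (v := (π (x - x₀) : Fin n → ℝ)) ?_ hx₀'
    rw [direction_affineSpan]
    exact (π (x - x₀)).2
  have hfix : ∀ x ∈ affineSpan ℝ K, (π (x - x₀) : Fin n → ℝ) + x₀ = x := fun x hx => by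
    have : x - x₀ ∈ vectorSpan ℝ K := by
      rw [← direction_affineSpan]
      exact AffineSubspace.vsub_mem_direction hx hx₀'
    rw [hπ' _ this, sub_add_cancel]
  have hcont : Continuous fun x : Fin n → ℝ => (π (x - x₀) : Fin n → ℝ) + x₀ := by
    have : Continuous π := LinearMap.continuous_of_finiteDimensional π
    fun_prop
  let φ : (Fin n → ℝ) → affineSpan ℝ K := fun x => ⟨_, hmem x⟩
  have hφ : Continuous φ := hcont.subtype_mk _
  -- `C` is the preimage of `K` under the affine projection onto its span.
  refine ⟨{x | (π (x - x₀) : Fin n → ℝ) + x₀ ∈ K}, ?_, ?_, ?_⟩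
  · intro x hx y hy s t hs ht hst
    have h := hK hx hy hs ht hst
    have e : s • x + t • y - x₀ = s • (x - x₀) + t • (y - x₀) := by
      have : x₀ = (s + t) • x₀ := by rw [hst, one_smul]
      conv_lhs => rw [this]
      module
    have e' : (π (s • x + t • y - x₀) : Fin n → ℝ) + x₀ =
        s • ((π (x - x₀) : Fin n → ℝ) + x₀) + t • ((π (y - x₀) : Fin n → ℝ) + x₀) := by
      have : s • x₀ + t • x₀ = x₀ := by rw [← add_smul, hst, one_smul]
      rw [e, map_add, map_smul, map_smul, smul_add, smul_add, add_add_add_comm, this]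
      rfl
    simpa only [mem_ofPred_eq, e'] using h
  · intro x hx
    rw [mem_ofPred_eq, hfix x hx]
  · ext x
    constructor
    · intro hx
      obtain ⟨y, hy, rfl⟩ := mem_intrinsicInterior.1 hx
      refine ⟨intrinsicInterior_subset hx, ?_⟩
      refine mem_interior.2 ⟨φ ⁻¹' interior ((↑) ⁻¹' K), fun z hz => ?_,
        isOpen_interior.preimage hφ, ?_⟩
      · exact interior_subset (s := ((↑) ⁻¹' K : Set (affineSpan ℝ K))) hz
      · have : φ y = y := Subtype.ext (hfix y y.2)
        rwa [mem_preimage, this]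
    · rintro ⟨hxK, hx⟩
      refine mem_intrinsicInterior.2 ⟨⟨x, subset_affineSpan ℝ K hxK⟩, ?_, rfl⟩
      refine mem_interior.2 ⟨Subtype.val ⁻¹' interior {x | (π (x - x₀) : Fin n → ℝ) + x₀ ∈ K},
        fun z hz => ?_, isOpen_interior.preimage continuous_subtype_val, hx⟩
      have h := interior_subset (mem_preimage.1 hz)
      rwa [mem_ofPred_eq, hfix z z.2] at h

/-- `U` is convex and open in a translate of the linear subspace `W`. -/
structure IsRelOpen (W : Submodule ℝ (Fin n → ℝ)) (U : Set (Fin n → ℝ)) : Prop where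
  convex : Convex ℝ U
  sub_mem : ∀ x ∈ U, ∀ y ∈ U, x - y ∈ W
  exists_add_mem : ∀ x ∈ U, ∀ w ∈ W, ∃ ε > (0 : ℝ), x + ε • w ∈ U

theorem exists_add_smul_mem_of_isOpen {O : Set (Fin n → ℝ)} (hO : IsOpen O) {x : Fin n → ℝ}
    (hx : x ∈ O) (w : Fin n → ℝ) : ∃ ε > (0 : ℝ), ∀ t, 0 ≤ t → t ≤ ε → x + t • w ∈ O := by
  have hc : Continuous fun t : ℝ => x + t • w := by fun_prop
  have h : ∀ᶠ t in 𝓝 (0 : ℝ), x + t • w ∈ O :=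
    hc.continuousAt.eventually_mem (hO.mem_nhds (by simpa using hx))
  obtain ⟨ε, hε, h⟩ := Metric.eventually_nhds_iff.1 h
  refine ⟨ε / 2, by positivity, fun t ht htε => h ?_⟩
  rw [Real.dist_eq, sub_zero, abs_of_nonneg ht]
  linarith

theorem isRelOpen_intrinsicInterior_inter {K Q : Set (Fin n → ℝ)} (hK : Convex ℝ K)
    (hQ : Convex ℝ Q) (hQo : IsOpen Q) :
    IsRelOpen (vectorSpan ℝ K) (intrinsicInterior ℝ K ∩ Q) := by
  obtain rfl | hne := K.eq_empty_or_nonempty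
  · constructor <;> simp [convex_empty]
  obtain ⟨C, hC, hCK, hint⟩ := exists_thickening hK hne
  rw [hint]
  refine ⟨(hK.inter hC.interior).inter hQ, ?_, ?_⟩
  · rintro x ⟨⟨hx, -⟩, -⟩ y ⟨⟨hy, -⟩, -⟩
    exact vsub_mem_vectorSpan ℝ hx hy
  · rintro x ⟨⟨hx, hxC⟩, hxQ⟩ w hw
    obtain ⟨ε, hε, h⟩ := exists_add_smul_mem_of_isOpen (isOpen_interior.inter hQo) ⟨hxC, hxQ⟩ w
    have h := h ε hε.le le_rfl
    refine ⟨ε, hε, ⟨?_, h.1⟩, h.2⟩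
    refine (hCK _ ?_).1 (interior_subset h.1)
    rw [add_comm]
    refine AffineSubspace.vadd_mem_of_mem_direction (v := ε • w) ?_ (subset_affineSpan ℝ K hx)
    rw [direction_affineSpan]
    exact Submodule.smul_mem _ _ hw

/-- Moving a point of `K ∩ Q` slightly towards a relative interior point of `K` enters the relative
interior without leaving `Q`. -/
theorem intrinsicInterior_inter_nonempty {K Q : Set (Fin n → ℝ)} (hK : Convex ℝ K)
    (hQo : IsOpen Q) (h : (K ∩ Q).Nonempty) : (intrinsicInterior ℝ K ∩ Q).Nonempty := by
  obtain ⟨x, hxK, hxQ⟩ := h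
  obtain ⟨z, hz⟩ := Set.Nonempty.intrinsicInterior hK ⟨x, hxK⟩
  obtain ⟨C, hC, hCK, hint⟩ := exists_thickening hK ⟨x, hxK⟩
  rw [hint] at hz ⊢
  obtain ⟨ε, hε, h⟩ := exists_add_smul_mem_of_isOpen hQo hxQ (z - x)
  set t := min ε (1 / 2)
  have ht : 0 < t := lt_min hε (by norm_num)
  have ht' : t ≤ 1 / 2 := min_le_right _ _
  have e : x + t • (z - x) = t • z + (1 - t) • x := by module
  have hxC : x ∈ C := (hCK x (subset_affineSpan ℝ K hxK)).2 hxK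
  refine ⟨x + t • (z - x), ⟨?_, ?_⟩, h t ht.le (min_le_left _ _)⟩
  · rw [e]
    exact hK hz.1 hxK ht.le (by linarith) (by ring)
  · rw [e]
    exact hC.openSegment_interior_self_subset_interior hz.2 hxC
      ⟨t, 1 - t, ht, by linarith, by ring, rfl⟩

/-- A point of a convex set outside its relative interior is on a proper exposed face. -/
theorem exists_support_of_notMem_intrinsicInterior {K : Set (Fin n → ℝ)} (hK : Convex ℝ K)
    {x : Fin n → ℝ} (hx : x ∈ K) (hx' : x ∉ intrinsicInterior ℝ K) :
    ∃ l : StrongDual ℝ (Fin n → ℝ), (∀ y ∈ K, l y ≤ l x) ∧ ∃ y ∈ K, l y < l x := by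
  obtain ⟨z, hz⟩ := Set.Nonempty.intrinsicInterior hK ⟨x, hx⟩
  obtain ⟨C, hC, hCK, hint⟩ := exists_thickening hK ⟨x, hx⟩
  rw [hint] at hz hx'
  obtain ⟨l, hl⟩ := geometric_hahn_banach_open_point hC.interior isOpen_interior
    (fun h => hx' ⟨hx, h⟩)
  refine ⟨l, fun y hy => ?_, z, hz.1, hl z hz.2⟩
  have hyC : y ∈ C := (hCK y (subset_affineSpan ℝ K hy)).2 hy
  by_contra! hlt
  have hseg : ∀ t : ℝ, 0 < t → t < 1 → t * l z + (1 - t) * l y < l x := fun t ht ht1 => by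
    have := hl _ (hC.openSegment_interior_self_subset_interior hz.2 hyC
      ⟨t, 1 - t, ht, by linarith, by ring, rfl⟩)
    simpa using this
  have hzx := hl z hz.2
  have hd : 0 < l y - l z := by linarith
  -- At this parameter the segment from `z` to `y` crosses the level `l x`, yet its points are
  -- interior to `C`, where `l < l x`.
  have := hseg ((l y - l x) / (l y - l z)) (div_pos (by linarith) hd)
    ((div_lt_one hd).2 (by linarith))
  have e : (l y - l x) / (l y - l z) * (l y - l z) = l y - l x := div_mul_cancel₀ _ hd.ne'
  nlinarith

/-- Segments in a convex set can be prolonged at points of the relative interior. -/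
theorem exists_prolong {K : Set (Fin n → ℝ)} (hK : Convex ℝ K) {x y : Fin n → ℝ}
    (hx : x ∈ intrinsicInterior ℝ K) (hy : y ∈ K) : ∃ ε > (0 : ℝ), x + ε • (x - y) ∈ K := by
  have h := isRelOpen_intrinsicInterior_inter hK convex_univ isOpen_univ
  obtain ⟨ε, hε, h⟩ := h.exists_add_mem x ⟨hx, trivial⟩ (x - y)
    (vsub_mem_vectorSpan ℝ (intrinsicInterior_subset hx) hy)
  exact ⟨ε, hε, intrinsicInterior_subset h.1⟩

theorem intrinsicInterior_subset_of_inter_nonempty {F P : Set (Fin n → ℝ)} (hF : Convex ℝ F)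
    (hP : Convex ℝ P) (hFP : F ⊆ P) (h : (F ∩ intrinsicInterior ℝ P).Nonempty) :
    intrinsicInterior ℝ F ⊆ intrinsicInterior ℝ P := by
  obtain ⟨y, hyF, hyP⟩ := h
  intro x hx
  obtain ⟨ε, hε, hq⟩ := exists_prolong hF hx hyF
  obtain ⟨C, hC, hCK, hint⟩ := exists_thickening hP ⟨y, hFP hyF⟩
  rw [hint] at hyP ⊢
  refine ⟨hFP (intrinsicInterior_subset hx), ?_⟩
  have hqC := (hCK _ (subset_affineSpan ℝ P (hFP hq))).2 (hFP hq)
  -- With `q = x + ε (x - y)`, one has `x = (ε y + q) / (1 + ε)`.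
  refine hC.openSegment_interior_self_subset_interior hyP.2 hqC
    ⟨ε / (1 + ε), 1 / (1 + ε), by positivity, by positivity, by field_simp; ring, ?_⟩
  have : (1 + ε) ≠ 0 := by positivity
  ext i
  simp only [Pi.add_apply, Pi.smul_apply, Pi.sub_apply, smul_eq_mul]
  field_simp
  ring

/-- If a functional maximal at `x` were smaller at some `y ∈ F`, prolonging the segment from `y`
beyond `x` inside `F` would exceed the maximum. -/
theorem eq_of_isExposed_of_mem_intrinsicInterior {F G : Set (Fin n → ℝ)} (hF : Convex ℝ F)
    (hG : IsExposed ℝ F G) {x : Fin n → ℝ} (hxG : x ∈ G) (hx : x ∈ intrinsicInterior ℝ F) :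
    G = F := by
  refine hG.subset.antisymm fun y hy => ?_
  obtain ⟨l, rfl⟩ := hG ⟨x, hxG⟩
  refine ⟨hy, fun z hz => ?_⟩
  obtain ⟨ε, hε, hq⟩ := exists_prolong hF hx hy
  have h1 := hxG.2 _ hq
  have h2 := hxG.2 z hz
  simp only [map_add, map_smul, map_sub, smul_eq_mul] at h1
  nlinarith

/-! ### Decomposition of a subdivided polytope into relatively open cells -/

section Subdivision

variable {P : Set (Fin n → ℝ)} {D : Set (Set (Fin n → ℝ))}

theorem IsSubdivision.convex (hD : IsSubdivision P D) {F : Set (Fin n → ℝ)} (hF : F ∈ D) :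
    Convex ℝ F := by
  obtain ⟨V, -, -, rfl⟩ := hD.isPolytope F hF
  exact convex_convexHull ℝ V

theorem IsSubdivision.subset (hD : IsSubdivision P D) {F : Set (Fin n → ℝ)} (hF : F ∈ D) :
    F ⊆ P := by
  rw [← hD.sUnion_eq]
  exact subset_sUnion_of_mem hF

theorem IsSubdivision.eq_of_mem_intrinsicInterior (hD : IsSubdivision P D)
    {F G : Set (Fin n → ℝ)} (hF : F ∈ D) (hG : G ∈ D) {x : Fin n → ℝ}
    (hxF : x ∈ intrinsicInterior ℝ F) (hxG : x ∈ intrinsicInterior ℝ G) : F = G := by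
  have hx : x ∈ F ∩ G := ⟨intrinsicInterior_subset hxF, intrinsicInterior_subset hxG⟩
  have h := hD.inter_face F hF G hG
  exact (eq_of_isExposed_of_mem_intrinsicInterior (hD.convex hF) h.1 hx hxF).symm.trans
    (eq_of_isExposed_of_mem_intrinsicInterior (hD.convex hG) h.2 hx hxG)

theorem IsSubdivision.exists_mem_intrinsicInterior (hD : IsSubdivision P D) {x : Fin n → ℝ}
    (hx : x ∈ P) : ∃ F ∈ D, x ∈ intrinsicInterior ℝ F := by
  have hfin : {F ∈ D | x ∈ F}.Finite := hD.finite.subset fun F hF => hF.1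
  have hne : {F ∈ D | x ∈ F}.Nonempty := by
    rw [← hD.sUnion_eq] at hx
    obtain ⟨F, hF, hxF⟩ := hx
    exact ⟨F, hF, hxF⟩
  -- A minimal cell containing `x` works: otherwise a supporting functional cuts out a smaller face
  -- through `x`.
  obtain ⟨F, hmin⟩ := hfin.exists_minimal hne
  obtain ⟨hF, hxF⟩ := hmin.prop
  refine ⟨F, hF, ?_⟩
  by_contra hx'
  obtain ⟨l, hl, y, hy, hlt⟩ := exists_support_of_notMem_intrinsicInterior (hD.convex hF) hxF hx'
  have hxG : x ∈ l.toExposed F := ⟨hxF, hl⟩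
  have hG := hD.face_mem F hF _ ⟨x, hxG⟩ ContinuousLinearMap.toExposed.isExposed
  have hsub : F ⊆ l.toExposed F := hmin.le_of_le ⟨hG, hxG⟩ fun z hz => hz.1
  exact absurd ((hsub hy).2 x hxF) (not_le.2 hlt)

theorem IsSubdivision.intrinsicInterior_subset_of_mem_internalFaces (hP : Convex ℝ P)
    (hD : IsSubdivision P D) {F : Set (Fin n → ℝ)} (hF : F ∈ internalFaces P D) :
    intrinsicInterior ℝ F ⊆ intrinsicInterior ℝ P := by
  refine intrinsicInterior_subset_of_inter_nonempty (hD.convex hF.1) hP (hD.subset hF.1) ?_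
  obtain ⟨y, hyF, hy⟩ := not_subset.1 hF.2
  have := subset_intrinsicClosure (𝕜 := ℝ) (hD.subset hF.1 hyF)
  rw [← intrinsicInterior_union_intrinsicFrontier] at this
  exact ⟨y, hyF, this.resolve_right hy⟩

theorem mem_internalFaces_of_mem_intrinsicInterior {F : Set (Fin n → ℝ)} (hF : F ∈ D)
    {x : Fin n → ℝ} (hx : x ∈ F) (hxP : x ∈ intrinsicInterior ℝ P) : F ∈ internalFaces P D := by
  refine ⟨hF, fun h => ?_⟩
  have h1 := h hx
  rw [← intrinsicClosure_sdiff_intrinsicInterior] at h1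
  exact h1.2 hxP

end Subdivision

/-! ### The Euler characteristic of relatively open convex sets -/

/-- If the points `l i = u i`, counted with weights `β`, and the open intervals `(l i, u i)`,
counted with weights `-β`, cancel everywhere, then the weights sum to zero. -/
theorem sum_eq_zero_of_intervals {ι : Type*} (s : Finset ι) (l u : ι → ℝ) (β : ι → ℤ)
    (hlu : ∀ i ∈ s, l i ≤ u i)
    (h : ∀ t : ℝ, ∑ i ∈ s with l i = t ∧ u i = t, β i = ∑ i ∈ s with l i < t ∧ t < u i, β i) :
    ∑ i ∈ s, β i = 0 := by
  classical
  -- Compare the relation at `t` with that at `r` just right of `t`. No `l i` equals `r`, and the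
  -- intervals containing `r` are those with `l i ≤ t < u i`. Subtracting leaves the indices with `l
  -- i = t`.
  have key : ∀ t : ℝ, ∑ i ∈ s with l i = t, β i = 0 := by
    intro t
    have hlt : ∀ b : ℝ, ∀ᶠ r in 𝓝[>] t, t < b → r < b := fun b => by
      by_cases hb : t < b
      · filter_upwards [nhdsWithin_le_nhds (Iio_mem_nhds hb)] with r hr _ using hr
      · exact Filter.Eventually.of_forall fun r hr => absurd hr hb
    have hev : ∀ᶠ r in 𝓝[>] t, ∀ i ∈ s, (t < l i → r < l i) ∧ (t < u i → r < u i) :=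
      (Filter.eventually_all_finset s).2 fun i _ => (hlt (l i)).and (hlt (u i))
    obtain ⟨r, hr, htr⟩ := (hev.and self_mem_nhdsWithin).exists
    replace htr : t < r := htr
    have h1 : ∑ i ∈ s with l i ≤ t ∧ t < u i, β i = 0 := by
      have h0 : (s.filter fun i => l i = r ∧ u i = r) = ∅ := by
        refine Finset.filter_eq_empty_iff.2 fun i hi => ?_
        rintro ⟨h2, -⟩
        have := (hr i hi).1 (by linarith)
        linarith
      have h2 := h r
      rw [h0, Finset.sum_empty] at h2
      rw [h2]
      refine Finset.sum_congr (Finset.filter_congr fun i hi => ?_) fun _ _ => rfl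
      obtain ⟨hl, hu⟩ := hr i hi
      constructor
      · rintro ⟨h3, h4⟩
        exact ⟨by linarith, hu h4⟩
      · rintro ⟨h3, h4⟩
        exact ⟨not_lt.1 fun h5 => by linarith [hl h5], by linarith⟩
    have h2 : ∑ i ∈ s with l i ≤ t ∧ t < u i, β i =
        ∑ i ∈ s with l i = t ∧ t < u i, β i + ∑ i ∈ s with l i < t ∧ t < u i, β i := by
      rw [← Finset.sum_union]
      · refine Finset.sum_congr ?_ fun _ _ => rfl
        ext i
        simp only [Finset.mem_filter, Finset.mem_union, le_iff_eq_or_lt]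
        tauto
      · refine Finset.disjoint_filter.2 fun i _ h3 h4 => h4.1.ne h3.1
    have h3 : ∑ i ∈ s with l i = t, β i =
        ∑ i ∈ s with l i = t ∧ t < u i, β i + ∑ i ∈ s with l i = t ∧ u i = t, β i := by
      rw [← Finset.sum_union]
      · refine Finset.sum_congr ?_ fun _ _ => rfl
        ext i
        simp only [Finset.mem_filter, Finset.mem_union]
        constructor
        · rintro ⟨hi, h4⟩
          rcases (h4 ▸ hlu i hi : t ≤ u i).lt_or_eq with h5 | h5
          · exact Or.inl ⟨hi, h4, h5⟩
          · exact Or.inr ⟨hi, h4, h5.symm⟩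
        · tauto
      · refine Finset.disjoint_filter.2 fun i _ h3 h4 => h3.2.ne h4.2.symm
    rw [h3, h t, ← h2, h1]
  rw [← Finset.sum_fiberwise_of_maps_to (t := s.image l) (g := l)
    fun i hi => Finset.mem_image_of_mem l hi]
  exact Finset.sum_eq_zero fun t _ => key t

theorem eq_Ioo_of_ordConnected {A : Set ℝ} (hA : A.OrdConnected) (hne : A.Nonempty)
    (hb : BddBelow A) (ha : BddAbove A) (h : ∀ x ∈ A, (∃ y ∈ A, y < x) ∧ ∃ y ∈ A, x < y) :
    A = Ioo (sInf A) (sSup A) := by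
  ext x
  constructor
  · intro hx
    obtain ⟨⟨y, hy, hyx⟩, z, hz, hxz⟩ := h x hx
    exact ⟨(csInf_le hb hy).trans_lt hyx, hxz.trans_le (le_csSup ha hz)⟩
  · rintro ⟨h1, h2⟩
    obtain ⟨y, hy, hyx⟩ := exists_lt_of_csInf_lt hne h1
    obtain ⟨z, hz, hxz⟩ := exists_lt_of_lt_csSup hne h2
    exact hA.out hy hz ⟨hyx.le, hxz.le⟩

theorem IsRelOpen.inter_hyperplane {W : Submodule ℝ (Fin n → ℝ)} {U : Set (Fin n → ℝ)}
    (h : IsRelOpen W U) (j : Fin n) (t : ℝ) :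
    IsRelOpen (W ⊓ LinearMap.ker (LinearMap.proj j : (Fin n → ℝ) →ₗ[ℝ] ℝ))
      (U ∩ {x | x j = t}) := by
  refine ⟨h.convex.inter ?_, ?_, ?_⟩
  · exact convex_hyperplane (f := fun x : Fin n → ℝ => x j) ⟨fun _ _ => rfl, fun _ _ => rfl⟩ t
  · rintro x ⟨hx, hxt⟩ y ⟨hy, hyt⟩
    refine ⟨h.sub_mem x hx y hy, ?_⟩
    simp only [mem_ofPred_eq] at hxt hyt
    simp [hxt, hyt]
  · rintro x ⟨hx, hxt⟩ w ⟨hw, hw'⟩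
    obtain ⟨ε, hε, hm⟩ := h.exists_add_mem x hx w hw
    have : w j = 0 := hw'
    exact ⟨ε, hε, hm, by simpa [this] using hxt⟩

/-- The values of a coordinate on a relatively open convex set form a point or an open
interval. -/
theorem IsRelOpen.exists_slice_nonempty_iff {W : Submodule ℝ (Fin n → ℝ)}
    {U : Set (Fin n → ℝ)} (h : IsRelOpen W U) (hne : U.Nonempty) (hb : Bornology.IsBounded U)
    (j : Fin n) :
    ∃ l u : ℝ, l ≤ u ∧
      (W ≤ LinearMap.ker (LinearMap.proj j : (Fin n → ℝ) →ₗ[ℝ] ℝ) → l = u ∧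
        ∀ t, (U ∩ {x | x j = t}).Nonempty ↔ l = t ∧ u = t) ∧
      (¬ W ≤ LinearMap.ker (LinearMap.proj j : (Fin n → ℝ) →ₗ[ℝ] ℝ) → l < u ∧
        ∀ t, (U ∩ {x | x j = t}).Nonempty ↔ l < t ∧ t < u) := by
  obtain ⟨p, hp⟩ := hne
  by_cases hW : W ≤ LinearMap.ker (LinearMap.proj j : (Fin n → ℝ) →ₗ[ℝ] ℝ)
  · refine ⟨p j, p j, le_rfl, fun _ => ⟨rfl, fun t => ?_⟩, fun h' => absurd hW h'⟩
    constructor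
    · rintro ⟨x, hx, rfl⟩
      have : p j - x j = 0 := hW (h.sub_mem p hp x hx)
      exact ⟨sub_eq_zero.1 this, sub_eq_zero.1 this⟩
    · rintro ⟨h1, -⟩
      exact ⟨p, hp, h1⟩
  · set A : Set ℝ := (fun x : Fin n → ℝ => x j) '' U
    obtain ⟨w, hw, hwj⟩ := SetLike.not_le_iff_exists.1 hW
    replace hwj : w j ≠ 0 := hwj
    have hAb : Bornology.IsBounded A := by
      obtain ⟨R, hR⟩ := isBounded_iff_forall_norm_le.1 hb
      refine isBounded_iff_forall_norm_le.2 ⟨R, ?_⟩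
      rintro _ ⟨x, hx, rfl⟩
      exact (norm_le_pi_norm x j).trans (hR x hx)
    have hAc : A.OrdConnected :=
      (h.convex.linear_image (LinearMap.proj j : (Fin n → ℝ) →ₗ[ℝ] ℝ)).ordConnected
    have hmove : ∀ x ∈ A, ∀ c : ℝ, ∃ ε > 0, x + ε * (c * w j) ∈ A := by
      rintro _ ⟨x, hx, rfl⟩ c
      obtain ⟨ε, hε, hm⟩ := h.exists_add_mem x hx (c • w) (W.smul_mem c hw)
      exact ⟨ε, hε, _, hm, by simp⟩
    have hA := eq_Ioo_of_ordConnected hAc ⟨_, p, hp, rfl⟩ hAb.bddBelow hAb.bddAbove ?_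
    · have hpA : p j ∈ A := ⟨p, hp, rfl⟩
      have hlt : sInf A < sSup A := by
        rw [hA] at hpA
        exact hpA.1.trans hpA.2
      refine ⟨sInf A, sSup A, hlt.le, fun h' => absurd h' hW, fun _ => ⟨hlt, fun t => ?_⟩⟩
      have : (U ∩ {x | x j = t}).Nonempty ↔ t ∈ A := Iff.rfl
      rw [this, ← mem_Ioo, ← hA]
    · intro x hx
      have hpos : 0 < w j * w j := mul_self_pos.2 hwj
      -- Scaling `w` by `∓ w j` moves coordinate `j` by a negative or positive multiple of `(w j) ^
      -- 2`.
      obtain ⟨ε, hε, h1⟩ := hmove x hx (-w j)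
      obtain ⟨δ, hδ, h2⟩ := hmove x hx (w j)
      exact ⟨⟨_, h1, by nlinarith [mul_pos hε hpos]⟩, _, h2, by nlinarith [mul_pos hδ hpos]⟩

/-- Rank-nullity: a functional nonzero on `W` cuts its dimension by one. -/
theorem neg_one_pow_finrank_inf_ker (W : Submodule ℝ (Fin n → ℝ)) (l : (Fin n → ℝ) →ₗ[ℝ] ℝ)
    (hW : ¬ W ≤ LinearMap.ker l) :
    (-1 : ℤ) ^ Module.finrank ℝ ↥(W ⊓ LinearMap.ker l) = -(-1) ^ Module.finrank ℝ W := by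
  have h1 := LinearMap.finrank_range_add_finrank_ker (l.domRestrict W)
  have h2 : LinearMap.range (l.domRestrict W) = ⊤ := by
    obtain ⟨w, hw, hwl⟩ := SetLike.not_le_iff_exists.1 hW
    refine LinearMap.range_eq_top.2 (LinearMap.surjective fun h0 => hwl ?_)
    exact LinearMap.congr_fun h0 ⟨w, hw⟩
  have h3 : Module.finrank ℝ (LinearMap.ker (l.domRestrict W)) =
      Module.finrank ℝ ↥(W ⊓ LinearMap.ker l) := by
    have e : (LinearMap.ker (l.domRestrict W)).map W.subtype = W ⊓ LinearMap.ker l := by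
      ext x
      simp [and_comm]
    rw [← e, Submodule.finrank_map_subtype_eq]
  rw [h2, finrank_top, Module.finrank_self, h3] at h1
  rw [← h1, pow_add]
  ring

open Classical in
/-- Linear relations between the indicator functions of bounded relatively open convex sets are
respected by the Euler characteristic with compact support. -/
theorem sum_euler_eq_zero {ι : Type*} (I : Finset ι) (α : ι → ℤ) (J : Finset (Fin n)) :
    ∀ (W : ι → Submodule ℝ (Fin n → ℝ)) (U : ι → Set (Fin n → ℝ)),
      (∀ i ∈ I, IsRelOpen (W i) (U i)) → (∀ i ∈ I, Bornology.IsBounded (U i)) →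
      (∀ i ∈ I, ∀ i' ∈ I, ∀ x ∈ U i, ∀ y ∈ U i', ∀ j ∉ J, x j = y j) →
      (∀ x, ∑ i ∈ I with x ∈ U i, α i = 0) →
      ∑ i ∈ I with (U i).Nonempty, α i * (-1) ^ Module.finrank ℝ (W i) = 0 := by
  -- `J` holds the coordinates not yet known to be constant on the union of the sets. When it is
  -- empty, all nonempty sets are one common point.
  induction J using Finset.induction_on with
  | empty =>
    intro W U hU _ hJ h
    by_cases hne : ∃ i ∈ I, (U i).Nonempty
    · obtain ⟨i₀, hi₀, p, hp⟩ := hne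
      have heq : ∀ i ∈ I, ∀ x ∈ U i, x = p := fun i hi x hx =>
        funext fun j => hJ i hi i₀ hi₀ x hx p hp j (Finset.notMem_empty j)
      have hiff : ∀ i ∈ I, (U i).Nonempty ↔ p ∈ U i := fun i hi =>
        ⟨fun ⟨x, hx⟩ => heq i hi x hx ▸ hx, fun h => ⟨p, h⟩⟩
      rw [← h p, Finset.filter_congr hiff]
      refine Finset.sum_congr rfl fun i hi => ?_
      obtain ⟨hi, hpi⟩ := Finset.mem_filter.1 hi
      have hW : W i = ⊥ := by
        refine (Submodule.eq_bot_iff _).2 fun w hw => ?_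
        obtain ⟨ε, hε, hm⟩ := (hU i hi).exists_add_mem p hpi w hw
        have := heq i hi _ hm
        rw [add_eq_left, smul_eq_zero] at this
        exact this.resolve_left hε.ne'
      rw [hW, finrank_bot, pow_zero, mul_one]
    · exact Finset.sum_eq_zero fun i hi => absurd ⟨i, Finset.mem_filter.1 hi⟩ hne
  | insert j J _ ih =>
    intro W U hU hb hJ h
    set k : Submodule ℝ (Fin n → ℝ) := LinearMap.ker (LinearMap.proj j : (Fin n → ℝ) →ₗ[ℝ] ℝ)
    have hslice : ∀ t : ℝ, ∑ i ∈ I with (U i ∩ {x | x j = t}).Nonempty,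
        α i * (-1) ^ Module.finrank ℝ ↥(W i ⊓ k) = 0 := by
      intro t
      refine ih (fun i => W i ⊓ k) (fun i => U i ∩ {x | x j = t})
        (fun i hi => (hU i hi).inter_hyperplane j t)
        (fun i hi => (hb i hi).subset inter_subset_left) ?_ fun x => ?_
      · rintro i hi i' hi' x ⟨hx, hxt⟩ y ⟨hy, hyt⟩ j' hj'
        by_cases hjj : j' = j
        · rw [hjj]
          exact Eq.trans hxt (Eq.symm hyt)
        · exact hJ i hi i' hi' x hx y hy j' (by simp [hjj, hj'])
      · by_cases hx : x j = t
        · simpa [hx] using h x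
        · simp [hx]
    have hlu : ∀ i : ι, ∃ l u : ℝ, i ∈ I → (U i).Nonempty → l ≤ u ∧
        (W i ≤ k → l = u ∧ ∀ t, (U i ∩ {x | x j = t}).Nonempty ↔ l = t ∧ u = t) ∧
        (¬ W i ≤ k → l < u ∧ ∀ t, (U i ∩ {x | x j = t}).Nonempty ↔ l < t ∧ t < u) := by
      intro i
      by_cases hi : i ∈ I ∧ (U i).Nonempty
      · obtain ⟨l, u, H⟩ := (hU i hi.1).exists_slice_nonempty_iff hi.2 (hb i hi.1) j
        exact ⟨l, u, fun _ _ => H⟩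
      · exact ⟨0, 0, fun h1 h2 => absurd ⟨h1, h2⟩ hi⟩
    choose l u hlu using hlu
    have hpoint : ∀ t, ∀ i ∈ I, ((U i).Nonempty ∧ l i = t ∧ u i = t) ↔
        ((U i ∩ {x | x j = t}).Nonempty ∧ W i ≤ k) := by
      intro t i hi
      constructor
      · rintro ⟨hne, h1, h2⟩
        have H := hlu i hi hne
        have hW : W i ≤ k := by
          by_contra hW
          linarith [(H.2.2 hW).1]
        exact ⟨((H.2.1 hW).2 t).2 ⟨h1, h2⟩, hW⟩
      · rintro ⟨h1, hW⟩
        have hne := h1.mono inter_subset_left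
        exact ⟨hne, (((hlu i hi hne).2.1 hW).2 t).1 h1⟩
    have hopen : ∀ t, ∀ i ∈ I, ((U i).Nonempty ∧ l i < t ∧ t < u i) ↔
        ((U i ∩ {x | x j = t}).Nonempty ∧ ¬ W i ≤ k) := by
      intro t i hi
      constructor
      · rintro ⟨hne, h1, h2⟩
        have H := hlu i hi hne
        have hW : ¬ W i ≤ k := fun hW => by linarith [(H.2.1 hW).1]
        exact ⟨((H.2.2 hW).2 t).2 ⟨h1, h2⟩, hW⟩
      · rintro ⟨h1, hW⟩
        have hne := h1.mono inter_subset_left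
        exact ⟨hne, (((hlu i hi hne).2.2 hW).2 t).1 h1⟩
    -- Slicing at `x j = t` keeps the sign of sets on which `x j` is constant and flips that of the
    -- others, so the induction hypothesis is exactly the cancellation of points against open
    -- intervals.
    refine sum_eq_zero_of_intervals _ l u _ (fun i hi => ?_) fun t => ?_
    · obtain ⟨hi, hne⟩ := Finset.mem_filter.1 hi
      exact (hlu i hi hne).1
    · have ht := hslice t
      rw [← Finset.sum_filter_add_sum_filter_not _ (fun i => W i ≤ k), add_eq_zero_iff_eq_neg,
        ← Finset.sum_neg_distrib] at ht
      rw [Finset.filter_filter, Finset.filter_filter] at ht ⊢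
      rw [Finset.filter_congr (hpoint t), Finset.filter_congr (hopen t)]
      convert ht using 1
      · refine Finset.sum_congr rfl fun i hi => ?_
        rw [inf_eq_left.2 (Finset.mem_filter.1 hi).2.2]
      · refine Finset.sum_congr rfl fun i hi => ?_
        rw [neg_one_pow_finrank_inf_ker _ _ (Finset.mem_filter.1 hi).2.2]
        ring

/-! ### Ranks and bases -/

theorem coe_rk (M : Mat n) (S : Finset (Fin n)) :
    ((M.1.eRk (S : Set (Fin n))).toNat : ℕ∞) = M.1.eRk (S : Set (Fin n)) := by
  refine ENat.natCast_toNat (ne_top_of_le_ne_top ?_ (M.1.eRk_le_encard _))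
  rw [Set.encard_coe_eq_coe_finsetCard]
  exact ENat.natCast_ne_top _

open Classical in
theorem card_filter_le_rk {M : Mat n} {B : Set (Fin n)} (hB : M.1.IsBase B)
    (S : Finset (Fin n)) : ((S.filter (· ∈ B)).card : ℤ) ≤ rk M S := by
  have h : ((S.filter (· ∈ B) : Finset (Fin n)) : Set (Fin n)).encard ≤
      M.1.eRk (S : Set (Fin n)) := by
    refine Matroid.Indep.encard_le_eRk_of_subset (hB.indep.subset ?_) ?_ <;> intro x <;>
      simp +contextual
  rw [Set.encard_coe_eq_coe_finsetCard, ← coe_rk] at h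
  exact Int.ofNat_le.2 (by exact_mod_cast h)

open Classical in
/-- Two nested sets have a basis of the matroid computing both of their ranks. -/
theorem exists_isBase_rk_eq (M : Mat n) {T S : Finset (Fin n)} (hTS : T ⊆ S) :
    ∃ B, M.1.IsBase B ∧ ((T.filter (· ∈ B)).card : ℤ) = rk M T ∧
      ((S.filter (· ∈ B)).card : ℤ) = rk M S := by
  -- Nestedness enters here: a basis of `T` extends to one of `S`, and then to one of `M`.
  obtain ⟨I, J, hI, hJ, hIJ⟩ := M.1.exists_isBasis_subset_isBasis
    (Finset.coe_subset.2 hTS) (by rw [M.2]; exact subset_univ _)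
  obtain ⟨B, hB, hJB⟩ := hJ.indep.exists_isBase_superset
  have key : ∀ (R : Finset (Fin n)) (L : Set (Fin n)), M.1.IsBasis L R → L ⊆ B →
      ((R.filter (· ∈ B)).card : ℤ) = rk M R := by
    intro R L hL hLB
    refine le_antisymm (card_filter_le_rk hB R) ?_
    have h : M.1.eRk (R : Set (Fin n)) ≤ ((R.filter (· ∈ B)).card : ℕ∞) := by
      rw [hL.eRk_eq_encard, ← Set.encard_coe_eq_coe_finsetCard]
      refine Set.encard_le_encard fun x hx => ?_
      simpa using ⟨hL.subset hx, hLB hx⟩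
    rw [← coe_rk] at h
    exact Int.ofNat_le.2 (by exact_mod_cast h)
  exact ⟨B, hB, key T I hI (hIJ.trans hJB), key S J hJ hJB⟩

theorem rank_eq_rk_univ (M : Mat n) : rank M = rk M Finset.univ := by
  rw [rank, rk, Finset.coe_univ, Matroid.eRk_univ_eq]

theorem rk_nonneg (M : Mat n) (S : Finset (Fin n)) : 0 ≤ rk M S := Int.natCast_nonneg _

theorem rk_le (M : Mat n) (S : Finset (Fin n)) : rk M S ≤ n := by
  classical
  obtain ⟨B, -, h, -⟩ := exists_isBase_rk_eq M (Finset.Subset.refl S)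
  rw [← h]
  exact_mod_cast (Finset.card_le_univ _).trans_eq (Fintype.card_fin n)

theorem a_univ (M : Mat n) (S : Finset (Fin n)) :
    a M Finset.univ S = c M S - ∑ T with T ⊂ S, a M Finset.univ T := by
  rw [a, Finset.sum_attach _ (a M Finset.univ)]

/-! ### Matroid polytopes -/

theorem convex_polytope (M : Mat n) : Convex ℝ (polytope M) := convex_convexHull ℝ _

theorem indicator_mem_polytope {M : Mat n} {B : Set (Fin n)} (hB : M.1.IsBase B) :
    B.indicator (fun _ => (1 : ℝ)) ∈ polytope M := subset_convexHull ℝ _ ⟨B, hB, rfl⟩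

theorem isBounded_polytope (M : Mat n) : Bornology.IsBounded (polytope M) := by
  refine isBounded_convexHull.2 ((Set.toFinite
    (range fun B : Set (Fin n) => B.indicator fun _ => (1 : ℝ))).subset ?_).isBounded
  rintro v ⟨B, -, rfl⟩
  exact ⟨B, rfl⟩

open Classical in
theorem sum_indicator (S : Finset (Fin n)) (B : Set (Fin n)) :
    ∑ e ∈ S, B.indicator (fun _ => (1 : ℝ)) e = (S.filter (· ∈ B)).card := by
  simp [Set.indicator_apply]

theorem isLinearMap_sum (S : Finset (Fin n)) :
    IsLinearMap ℝ fun x : Fin n → ℝ => ∑ e ∈ S, x e :=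
  ⟨fun x y => by simp [Finset.sum_add_distrib], fun t x => by simp [Finset.mul_sum]⟩

theorem sum_le_rk_of_mem_polytope {M : Mat n} {x : Fin n → ℝ} (hx : x ∈ polytope M)
    (S : Finset (Fin n)) : ∑ e ∈ S, x e ≤ rk M S := by
  classical
  refine convexHull_min (t := {x : Fin n → ℝ | ∑ e ∈ S, x e ≤ rk M S}) ?_
    (convex_halfSpace_le (isLinearMap_sum S) _) hx
  rintro _ ⟨B, hB, rfl⟩
  rw [mem_ofPred_eq, sum_indicator]
  exact_mod_cast card_filter_le_rk hB S

/-- The affine function `l` takes at the indicator of `A` minus the number of elements where `A` and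
`B` differ: at most `-1` at all bases if `B` is not one, but `0` at `B`. -/
theorem isBase_of_indicator_mem_polytope {M : Mat n} {B : Set (Fin n)}
    (hB : B.indicator (fun _ => (1 : ℝ)) ∈ polytope M) : M.1.IsBase B := by
  classical
  by_contra hnot
  let f : Set (Fin n) → Fin n → ℝ := fun A => A.indicator fun _ => 1
  have hf : ∀ A e, f A e = if e ∈ A then 1 else 0 := fun A e => Set.indicator_apply _ _ _
  let l : (Fin n → ℝ) → ℝ := fun x => ∑ e, (2 * f B e - 1) * (x e - f B e)
  have hl : ConvexOn ℝ univ l := by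
    refine ⟨convex_univ, fun x _ y _ s t _ _ hst => le_of_eq ?_⟩
    simp only [l, smul_eq_mul, Finset.mul_sum, ← Finset.sum_add_distrib]
    refine Finset.sum_congr rfl fun e _ => ?_
    have : t = 1 - s := by linarith
    subst this
    simp only [Pi.add_apply, Pi.smul_apply, smul_eq_mul]
    ring
  have hmem := convexHull_min (t := {x ∈ univ | l x ≤ -1}) ?_ (hl.convex_le _) hB
  · have : l (f B) = 0 := by simp [l]
    have h2 : l (f B) ≤ -1 := hmem.2
    linarith
  · rintro _ ⟨A, hA, rfl⟩
    refine ⟨trivial, ?_⟩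
    have hAB : A ≠ B := fun h => hnot (h ▸ hA)
    obtain ⟨e, he⟩ : ∃ e, ¬ (e ∈ A ↔ e ∈ B) := by
      by_contra! h
      exact hAB (Set.ext h)
    have hterm : ∀ e, (2 * f B e - 1) * (f A e - f B e) = if e ∈ A ↔ e ∈ B then 0 else -1 := by
      intro e
      rw [hf, hf]
      by_cases h1 : e ∈ A <;> by_cases h2 : e ∈ B <;> norm_num [h1, h2]
    change ∑ e, (2 * f B e - 1) * (f A e - f B e) ≤ -1
    rw [← Finset.add_sum_erase _ _ (Finset.mem_univ e), hterm, if_neg he]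
    have : ∑ e ∈ Finset.univ.erase e, (2 * f B e - 1) * (f A e - f B e) ≤ 0 :=
      Finset.sum_nonpos fun e _ => by rw [hterm]; split_ifs <;> norm_num
    linarith

theorem polytope_injective : Function.Injective (polytope : Mat n → Set (Fin n → ℝ)) := by
  intro M N h
  refine Subtype.ext (Matroid.ext_isBase (M.2.trans N.2.symm) fun B _ =>
    ⟨fun hB => ?_, fun hB => ?_⟩)
  · exact isBase_of_indicator_mem_polytope (h ▸ indicator_mem_polytope hB)
  · exact isBase_of_indicator_mem_polytope (h ▸ indicator_mem_polytope hB)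

/-! ### Valuative functions -/

section Closure

variable {A : Type*} [AddCommGroup A] {f g : Mat n → A}

theorem IsValuative.add (hf : IsValuative f) (hg : IsValuative g) :
    IsValuative fun M => f M + g M := by
  intro M D hD
  simp only [smul_add, Finset.sum_add_distrib]
  rw [← hf M D hD, ← hg M D hD]

theorem IsValuative.zsmul (hf : IsValuative f) (k : ℤ) : IsValuative fun M => k • f M := by
  intro M D hD
  simp only [smul_comm _ k, ← Finset.smul_sum]
  rw [← hf M D hD]

theorem IsValuative.sub (hf : IsValuative f) (hg : IsValuative g) :
    IsValuative fun M => f M - g M := by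
  simpa [sub_eq_add_neg] using hf.add (hg.zsmul (-1))

theorem IsValuative.sum {ι : Type*} {s : Finset ι} {f : ι → Mat n → A}
    (hf : ∀ i ∈ s, IsValuative (f i)) : IsValuative fun M => ∑ i ∈ s, f i M := by
  intro M D hD
  simp only [Finset.smul_sum]
  rw [Finset.sum_comm]
  exact Finset.sum_congr rfl fun i hi => hf i hi M D hD

end Closure

theorem neg_one_pow_sub_mul {d e : ℕ} (h : e ≤ d) :
    (-1 : ℤ) ^ (d - e) = (-1) ^ d * (-1) ^ e := by
  obtain ⟨k, rfl⟩ := Nat.exists_eq_add_of_le h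
  rw [Nat.add_sub_cancel_left, pow_add, mul_right_comm, ← mul_pow]
  simp

open Classical in
/-- Meeting a fixed open convex set is a valuative property. -/
theorem isValuative_inter_nonempty {Q : Set (Fin n → ℝ)} (hQ : Convex ℝ Q) (hQo : IsOpen Q) :
    IsValuative fun M : Mat n => if (polytope M ∩ Q).Nonempty then (1 : ℤ) else 0 := by
  intro M D hD
  set s : Finset (Mat n) := Finset.univ.filter fun N => polytope N ∈ internalFaces (polytope M) D
  have hs : ∀ N, N ∈ s ↔ polytope N ∈ internalFaces (polytope M) D := by simp [s]
  -- The index `none` stands for `M` itself, with weight `-1`; internal cells get weight `1`.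
  let R : Option (Mat n) → Mat n := fun i => i.getD M
  have hiff : ∀ N : Mat n, (intrinsicInterior ℝ (polytope N) ∩ Q).Nonempty ↔
      (polytope N ∩ Q).Nonempty := fun N =>
    ⟨fun h => h.mono (inter_subset_inter_left _ intrinsicInterior_subset),
      intrinsicInterior_inter_nonempty (convex_polytope N) hQo⟩
  have key := sum_euler_eq_zero (Finset.insertNone s) (fun i => i.elim (-1) fun _ => 1)
    Finset.univ (fun i => vectorSpan ℝ (polytope (R i)))
    (fun i => intrinsicInterior ℝ (polytope (R i)) ∩ Q)
    (fun i _ => isRelOpen_intrinsicInterior_inter (convex_polytope _) hQ hQo)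
    (fun i _ => (isBounded_polytope (R i)).subset
      (inter_subset_left.trans intrinsicInterior_subset))
    (fun _ _ _ _ _ _ _ _ j hj => absurd (Finset.mem_univ j) hj) ?_
  · rw [Finset.sum_filter, Finset.sum_insertNone] at key
    simp only [R, Option.getD_none, Option.getD_some, Option.elim_none, Option.elim_some,
      hiff] at key
    have hM : (if (polytope M ∩ Q).Nonempty then -1 * (-1 : ℤ) ^ dim (polytope M) else 0) =
        - ((-1) ^ dim (polytope M) * if (polytope M ∩ Q).Nonempty then (1 : ℤ) else 0) := by
      split_ifs <;> ring
    change (if (polytope M ∩ Q).Nonempty then -1 * (-1 : ℤ) ^ dim (polytope M) else 0) +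
      ∑ N ∈ s, (if (polytope N ∩ Q).Nonempty then 1 * (-1 : ℤ) ^ dim (polytope N) else 0) = 0
      at key
    rw [hM, neg_add_eq_zero] at key
    have h2 : ((-1 : ℤ) ^ dim (polytope M)) * (-1) ^ dim (polytope M) = 1 := by
      rw [← mul_pow]
      simp
    replace key := congrArg ((-1 : ℤ) ^ dim (polytope M) * ·) key
    simp only [← mul_assoc, h2, one_mul, Finset.mul_sum] at key
    refine key.trans ?_
    refine Finset.sum_congr rfl fun N hN => ?_
    -- Needed because the exponent is a truncated subtraction.
    have hle : dim (polytope N) ≤ dim (polytope M) :=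
      Submodule.finrank_mono (vectorSpan_mono ℝ (hD.subset ((hs N).1 hN).1))
    rw [neg_one_pow_sub_mul hle]
    split_ifs with h <;> simp [h]
  · intro x
    rw [Finset.sum_filter, Finset.sum_insertNone]
    simp only [R, Option.getD_none, Option.getD_some, Option.elim_none, Option.elim_some]
    by_cases hx : x ∈ intrinsicInterior ℝ (polytope M) ∩ Q
    · obtain ⟨F, hF, hxF⟩ := hD.exists_mem_intrinsicInterior (intrinsicInterior_subset hx.1)
      obtain ⟨N, rfl⟩ := hD.isMatroidPolytope F hF
      have hN : N ∈ s := (hs N).2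
        (mem_internalFaces_of_mem_intrinsicInterior hF (intrinsicInterior_subset hxF) hx.1)
      rw [if_pos hx, Finset.sum_eq_single_of_mem N hN, if_pos ⟨hxF, hx.2⟩]
      · norm_num
      · intro N' hN' hne
        refine if_neg fun h => hne (polytope_injective ?_)
        exact hD.eq_of_mem_intrinsicInterior ((hs N').1 hN').1 hF h.1 hxF
    · rw [if_neg hx, zero_add]
      refine Finset.sum_eq_zero fun N hN => if_neg fun h => hx ⟨?_, h.2⟩
      exact hD.intrinsicInterior_subset_of_mem_internalFaces (convex_polytope M) ((hs N).1 hN) h.1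

/-- Lower bounds on the ranks of two nested sets form a valuative property. -/
theorem isValuative_le_rk {T S : Finset (Fin n)} (hTS : T ⊆ S) (i j : ℤ) :
    IsValuative fun M : Mat n => if i ≤ rk M T ∧ j ≤ rk M S then (1 : ℤ) else 0 := by
  classical
  -- The ranks are integers, so the shift by `1/2` turns the closed conditions into open ones.
  let Q : Set (Fin n → ℝ) :=
    {x | (i : ℝ) - 1 / 2 < ∑ e ∈ T, x e} ∩ {x | (j : ℝ) - 1 / 2 < ∑ e ∈ S, x e}
  have hQ : Convex ℝ Q := (convex_halfSpace_gt (isLinearMap_sum T) _).inter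
    (convex_halfSpace_gt (isLinearMap_sum S) _)
  have hQo : IsOpen Q := (isOpen_lt continuous_const (by fun_prop)).inter
    (isOpen_lt continuous_const (by fun_prop))
  convert isValuative_inter_nonempty hQ hQo using 3 with M
  have hround : ∀ a b : ℤ, (a : ℝ) - 1 / 2 < b → a ≤ b := fun a b h => by
    have : (a : ℝ) < (b + 1 : ℤ) := by push_cast; linarith
    exact Int.lt_add_one_iff.1 (by exact_mod_cast this)
  constructor
  · rintro ⟨hi, hj⟩
    obtain ⟨B, hB, hT, hS⟩ := exists_isBase_rk_eq M hTS
    refine ⟨_, indicator_mem_polytope hB, ?_, ?_⟩ <;> rw [mem_ofPred_eq, sum_indicator]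
    · have : (i : ℝ) ≤ ((T.filter (· ∈ B)).card : ℤ) := by exact_mod_cast hT ▸ hi
      push_cast at this
      linarith
    · have : (j : ℝ) ≤ ((S.filter (· ∈ B)).card : ℤ) := by exact_mod_cast hS ▸ hj
      push_cast at this
      linarith
  · rintro ⟨x, hx, hxT, hxS⟩
    exact ⟨hround _ _ (lt_of_lt_of_le hxT (sum_le_rk_of_mem_polytope hx T)),
      hround _ _ (lt_of_lt_of_le hxS (sum_le_rk_of_mem_polytope hx S))⟩

theorem eq_sum_range_ite {r : ℤ} (h0 : 0 ≤ r) (hn : r ≤ n) :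
    r = ∑ i ∈ Finset.range n, if (i : ℤ) + 1 ≤ r then (1 : ℤ) else 0 := by
  lift r to ℕ using h0
  have : (Finset.range n).filter (fun i : ℕ => (i : ℤ) + 1 ≤ r) = Finset.range r := by
    ext i
    simp only [Finset.mem_filter, Finset.mem_range]
    omega
  rw [← Finset.sum_filter, this]
  simp

theorem isValuative_rk_mul_rk {T S : Finset (Fin n)} (hTS : T ⊆ S) :
    IsValuative fun M : Mat n => rk M T * rk M S := by
  have h : IsValuative fun M : Mat n => ∑ i ∈ Finset.range n, ∑ j ∈ Finset.range n,
      if (i : ℤ) + 1 ≤ rk M T ∧ (j : ℤ) + 1 ≤ rk M S then (1 : ℤ) else 0 :=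
    IsValuative.sum fun i _ => IsValuative.sum fun j _ => isValuative_le_rk hTS _ _
  convert h using 2 with M
  conv_lhs => rw [eq_sum_range_ite (rk_nonneg M T) (rk_le M T),
    eq_sum_range_ite (rk_nonneg M S) (rk_le M S), Finset.sum_mul_sum]
  refine Finset.sum_congr rfl fun i _ => Finset.sum_congr rfl fun j _ => ?_
  rw [ite_and]
  split_ifs <;> simp

theorem isValuative_rk (S : Finset (Fin n)) : IsValuative fun M : Mat n => rk M S := by
  have h : IsValuative fun M : Mat n => ∑ j ∈ Finset.range n,
      -- The first condition is vacuous; it gives the shape of `isValuative_le_rk` with `T = S`.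
      if 0 ≤ rk M S ∧ (j : ℤ) + 1 ≤ rk M S then (1 : ℤ) else 0 :=
    IsValuative.sum fun j _ => isValuative_le_rk (Finset.Subset.refl S) _ _
  convert h using 2 with M
  simpa [rk_nonneg] using eq_sum_range_ite (rk_nonneg M S) (rk_le M S)

/-- The recursion for `a` only descends to subsets of `S`, so each product of ranks that arises
involves a set contained in `R`. -/
theorem isValuative_rk_mul_a {R : Finset (Fin n)} (S : Finset (Fin n)) (hSR : S ⊆ R) :
    IsValuative fun M : Mat n => rk M R * a M Finset.univ S := by
  induction S using Finset.strongInduction with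
  | H S ih =>
    have h := (((isValuative_rk R).zsmul S.card).sub (isValuative_rk_mul_rk hSR)).sub
      (IsValuative.sum (s := Finset.univ.filter (· ⊂ S)) fun T hT =>
        ih T (Finset.mem_filter.1 hT).2 ((Finset.mem_filter.1 hT).2.subset.trans hSR))
    convert h using 2 with M
    rw [a_univ, c, mul_sub, mul_sub, Finset.mul_sum, smul_eq_mul]
    ring

theorem isValuative_ec : IsValuative fun M : Mat n => ec M := by
  have h := IsValuative.sum (s := Finset.univ) fun (S : Finset (Fin n)) _ =>
    (isValuative_rk_mul_a S (Finset.subset_univ S)).sub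
      (isValuative_rk_mul_a S (Finset.Subset.refl S))
  convert h using 2 with M
  simp only [ec, ecWith, rank_eq_rk_univ, sub_mul]

/-! ### Invariance -/

/-- A basis meeting `S` in `rk S` elements is carried to a basis meeting the image equally often. -/
theorem rk_le_rk_map {M N : Mat n} {σ : Equiv.Perm (Fin n)}
    (h : ∀ B : Set (Fin n), M.1.IsBase B → N.1.IsBase (σ '' B)) (S : Finset (Fin n)) :
    rk M S ≤ rk N (S.map σ.toEmbedding) := by
  classical
  obtain ⟨B, hB, hS, -⟩ := exists_isBase_rk_eq M (Finset.Subset.refl S)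
  rw [← hS]
  convert card_filter_le_rk (h B hB) (S.map σ.toEmbedding) using 2
  rw [Finset.filter_map, Finset.card_map]
  congr 1
  ext x
  simp

theorem rk_eq_rk_map {M N : Mat n} {σ : Equiv.Perm (Fin n)}
    (h : ∀ B : Set (Fin n), M.1.IsBase B ↔ N.1.IsBase (σ '' B)) (S : Finset (Fin n)) :
    rk M S = rk N (S.map σ.toEmbedding) := by
  refine le_antisymm (rk_le_rk_map (fun B => (h B).1) S) ?_
  have h' := rk_le_rk_map (M := N) (N := M) (σ := σ.symm)
    (fun B hB => (h _).2 (by simpa [Set.image_image] using hB)) (S.map σ.toEmbedding)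
  have e : (S.map σ.toEmbedding).map σ.symm.toEmbedding = S := by
    ext x
    simp
  rwa [e] at h'

theorem a_eq_a_map {M N : Mat n} {σ : Equiv.Perm (Fin n)}
    (h : ∀ B : Set (Fin n), M.1.IsBase B ↔ N.1.IsBase (σ '' B)) (S : Finset (Fin n)) :
    a M Finset.univ S = a N Finset.univ (S.map σ.toEmbedding) := by
  induction S using Finset.strongInduction with
  | H S ih =>
    rw [a_univ, a_univ, c, c, rk_eq_rk_map h, Finset.card_map]
    congr 1
    refine Finset.sum_equiv σ.finsetCongr (fun T => ?_)
      fun T hT => ih T (Finset.mem_filter.1 hT).2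
    simp [Finset.map_ssubset_map]

theorem isInvariant_ec : IsInvariant fun M : Mat n => ec M := by
  intro M N σ h
  simp only [ec, ecWith]
  refine Fintype.sum_equiv σ.finsetCongr _ _ fun S => ?_
  rw [rank_eq_rk_univ, rank_eq_rk_univ, rk_eq_rk_map h, rk_eq_rk_map h S, a_eq_a_map h,
    Finset.map_univ_equiv]
  rfl

end MatroidEC

theorem theorem5p2 (n : ℕ) :
    MatroidEC.IsInvariant (fun M : MatroidEC.Mat n => MatroidEC.ec M) ∧
      MatroidEC.IsValuative (fun M : MatroidEC.Mat n => MatroidEC.ec M) :=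
  ⟨MatroidEC.isInvariant_ec, MatroidEC.isValuative_ec⟩
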